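/- Let $\Theta\in\mathbb R^{n\times n}$ be a non-singular antisymmetric matrix, and let $X=(X_1,\dots,X_n)^{\mathsf T}$ be a vector of symmetric operators on a common dense invariant domain $\mathcal D$ of a complex Hilbert space $\mathfrak H$, satisfying the canonical commutation relations $[X_j,X_k]=2i\Theta_{jk}$ on $\mathcal D$, where every $\psi\in\mathcal D$ is an entire analytic vector: for every $r>0$ there is $C$ with $\|X_{j_1}\cdots X_{j_k}\psi\|\le C\,k!/r^{k}$ for all $k$ and $j_1,\dots,j_k$. For $\lambda\in\mathbb R^n$ let $e^{i\lambda^{\mathsf T}X}$ be the bounded operator on $\mathfrak H$ given on $\mathcal D$ by the exponential series. Let $h:\mathbb R^n\to\mathbb C$ satisfy $h(-\lambda)=\overline{h(\lambda)}$ and $\int_{\mathbb R^n}(1+|\lambda|)|h(\lambda)|\,d\lambda<\infty$ (for example, $h(\lambda)=(2\pi)^{-n}\int_{\mathbb R^n} H_1(x)e^{-i\lambda^{\mathsf T}x}\,dx$ for a real-valued function $H_1$, if this $h$ is so integrable). Put $$H_1:=\int_{\mathbb R^n}h(\lambda)e^{i\lambda^{\mathsf T}X}\,d\lambda,\qquad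 Z:=i[H_1,X],$$ $$\widetilde h(\lambda):=\int_{\mathbb R^n}h(\lambda-\tau)h(\tau)(\lambda-\tau)\tau^{\mathsf T}e^{i\tau^{\mathsf T}\Theta\lambda}\,d\tau\in\mathbb C^{n\times n},$$ where operator-valued integrals are taken strongly and the commutators are formed with the closures of $X_1,\dots,X_n$. For matrices of operators defined on $\mathcal D$, $K\preccurlyeq L$ means that $M:=L-K$ is superpositive, that is, $M_{jk}$ and $M_{kj}$ are formal adjoints of each other on $\mathcal D$ for all $j,k$, and $\sum_{j,k}\overline{u_j}u_kM_{jk}$ is positive semi-definite on $\mathcal D$ for every $u\in\mathbb C^n$. Then the exponentials are well-defined bounded operators, the integrals for $H_1$ and $\int\widetilde h(\lambda)e^{i\lambda^{\mathsf T}X}d\lambda$ converge absolutely in the strong sense, the integral for $\widetilde h(\lambda)$ converges absolutely for almost every $\lambda$, $H_1$ maps the domain of the closure of each $X_j$ into itself, and each $Z_j$ extends to a bounded operator on $\mathfrak H$. Moreover, $$ZZ^{\mathsf T}=4\Theta\int_{\mathbb R^n}\widetilde h(\lambda)e^{i\lambda^{\mathsf T}X}\,d\lambda\;\Theta.$$ Consequently,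 for all $d$, all $\Gamma_1,\dots,\Gamma_d\in\mathbb R^{n\times n}$ and all $\mu_1,\mu_0\in\mathbb R$, the operator inequality $$ZZ^{\mathsf T}\preccurlyeq\mu_1\sum_{k=1}^d\Gamma_kXX^{\mathsf T}\Gamma_k^{\mathsf T}+\mu_0I_n$$ holds if and only if $$4\Theta\int_{\mathbb R^n}\widetilde h(\lambda)e^{i\lambda^{\mathsf T}X}\,d\lambda\;\Theta\preccurlyeq\mu_1\sum_{k=1}^d\Gamma_kXX^{\mathsf T}\Gamma_k^{\mathsf T}+\mu_0I_n .$$ -/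

import Mathlib

open MeasureTheory

open scoped Nat InnerProductSpace

/-- System variables `X₁, …, Xₙ` on a complex Hilbert space `H` satisfying the canonical commutation
relations `[X, Xᵀ] = 2iΘ`.  The `X j` are symmetric operators on a common dense invariant domain
`dom` of vectors which are entire analytic for them: the norms of all products of length `k` applied
to such a vector grow more slowly than `k! / r ^ k` for every `r > 0`.  (By Nelson's theorem the
closures of all the real linear combinations of the `X j` are then self-adjoint.  Some such
requirement is needed for unbounded operators, as commutation relations on a dense domain alone do
not determine the products of the exponentials.) -/
structure CCRSystem {n : ℕ} (Θ : Matrix (Fin n) (Fin n) ℝ) (H : Type*)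
    [NormedAddCommGroup H] [InnerProductSpace ℂ H] where
  dom : Submodule ℂ H
  dense_dom : Dense (dom : Set H)
  X : Fin n → Module.End ℂ dom
  symm : ∀ (j : Fin n) (χ ψ : dom), ⟪(X j χ : H), (ψ : H)⟫_ℂ = ⟪(χ : H), (X j ψ : H)⟫_ℂ
  ccr : ∀ j k : Fin n, X j * X k - X k * X j = (2 * Complex.I * (Θ j k : ℂ)) • (1 : Module.End ℂ dom)
  entire : ∀ (ψ : dom) (r : ℝ), 0 < r → ∃ C : ℝ, ∀ w : List (Fin n),
    ‖((w.map X).prod ψ : H)‖ ≤ C * (w.length ! : ℝ) / r ^ w.length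

noncomputable section

section Operators

variable {H : Type*} [NormedAddCommGroup H] [InnerProductSpace ℂ H]

/-- `U` is the bounded operator `exp (iA)`: on the domain of `A` it is given by the power series. -/
def IsExpI {D : Submodule ℂ H} (A : Module.End ℂ D) (U : H →L[ℂ] H) : Prop :=
  ∀ ψ : D, HasSum (fun k : ℕ => (Complex.I ^ k / (k ! : ℂ)) • ((A ^ k) ψ : H)) (U (ψ : H))

open Classical in
/-- The bounded operator `exp (iA)` (`0` if there is none; it is unique if `D` is dense). -/
def expI {D : Submodule ℂ H} (A : Module.End ℂ D) : H →L[ℂ] H :=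
  if h : ∃ U : H →L[ℂ] H, IsExpI A U then h.choose else 0

/-- `T = ∫ F(ξ) dξ` as an absolutely convergent integral in the strong operator sense. -/
def IsStrongIntegral {E : Type*} [MeasureSpace E] (F : E → H →L[ℂ] H) (T : H →L[ℂ] H) : Prop :=
  ∀ ψ : H, Integrable (fun ξ => F ξ ψ) ∧ T ψ = ∫ ξ, F ξ ψ

open Classical in
/-- The bounded operator `∫ F(ξ) dξ` (`0` if there is none). -/
def strongIntegral {E : Type*} [MeasureSpace E] (F : E → H →L[ℂ] H) : H →L[ℂ] H :=
  if h : ∃ T : H →L[ℂ] H, IsStrongIntegral F T then h.choose else 0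

/-- `C` is the commutator `[T, A] = T A - A T` of a bounded operator `T` with an unbounded operator
`A`: `T` leaves the domain of `A` invariant, and the bounded operator `C` agrees with `T A - A T`
there. -/
def IsCommutator (T : H →L[ℂ] H) (A : H →ₗ.[ℂ] H) (C : H →L[ℂ] H) : Prop :=
  ∀ ψ : A.domain, ∃ h : T (ψ : H) ∈ A.domain, C (ψ : H) = T (A ψ) - A ⟨T (ψ : H), h⟩

open Classical in
/-- The bounded operator `[T, A]` (`0` if there is none; it is unique if `A` is densely defined). -/
def bddCommutator (T : H →L[ℂ] H) (A : H →ₗ.[ℂ] H) : H →L[ℂ] H :=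
  if h : ∃ C : H →L[ℂ] H, IsCommutator T A C then h.choose else 0

/-- Superpositiveness of a matrix `L` of operators on a common domain `D`: `L† = L`, and the operator
`u* L u = ∑ j k, conj (u j) u k L j k` is positive semi-definite for every complex vector `u`. -/
def Superpositive {ι : Type*} [Fintype ι] {D : Submodule ℂ H} (L : Matrix ι ι (D →ₗ[ℂ] H)) : Prop :=
  (∀ (j k : ι) (χ ψ : D), ⟪L j k χ, (ψ : H)⟫_ℂ = ⟪(χ : H), L k j ψ⟫_ℂ) ∧
  ∀ (u : ι → ℂ) (ψ : D),
    0 ≤ (⟪(ψ : H), ∑ j, ∑ k, (starRingEnd ℂ (u j) * u k) • L j k ψ⟫_ℂ).re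

/-- The ordering `K ≼ L` of matrices of operators on `D` in the sense of superpositiveness. -/
def SuperLE {ι : Type*} [Fintype ι] {D : Submodule ℂ H} (K L : Matrix ι ι (D →ₗ[ℂ] H)) : Prop :=
  Superpositive (L - K)

/-- A matrix of bounded operators, restricted to the domain `D`. -/
def boundedOn {ι : Type*} (D : Submodule ℂ H) (L : Matrix ι ι (H →L[ℂ] H)) :
    Matrix ι ι (D →ₗ[ℂ] H) :=
  L.map fun T => (T : H →ₗ[ℂ] H) ∘ₗ D.subtype

/-- A matrix of operators from `D` to `D`, regarded as operators from `D` to `H`. -/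
def invariantOn {ι : Type*} (D : Submodule ℂ H) (L : Matrix ι ι (Module.End ℂ D)) :
    Matrix ι ι (D →ₗ[ℂ] H) :=
  L.map fun T => D.subtype ∘ₗ T

/-- A real matrix as a matrix of scalar operators. -/
def scalarMat {ι : Type*} (R : Type*) [Ring R] [Module ℂ R] (M : Matrix ι ι ℝ) : Matrix ι ι R :=
  M.map fun a => (a : ℂ) • (1 : R)

end Operators

/-- The functions `h` of the Weyl quantization `∫ h(ξ) exp (i ξᵀX) dξ` of real-valued functions:
Hermitian symmetric, with `h` and `ξ h(ξ)` absolutely integrable. -/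
structure WeylSymbol (n : ℕ) where
  h : EuclideanSpace ℝ (Fin n) → ℂ
  symm : ∀ ξ, h (-ξ) = starRingEnd ℂ (h ξ)
  integrable : Integrable h
  integrable_moment : Integrable fun ξ => ‖ξ‖ * ‖h ξ‖

/-- The Fourier transform `h(ξ) = (2π)⁻ⁿ ∫ f(x) exp (-i ξᵀx) dx` of a function `f` of `n` real
classical variables. -/
def classicalFourier {n : ℕ} (f : EuclideanSpace ℝ (Fin n) → ℝ) (ξ : EuclideanSpace ℝ (Fin n)) : ℂ :=
  (((2 * Real.pi) ^ n : ℝ) : ℂ)⁻¹ *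
    ∫ x : EuclideanSpace ℝ (Fin n), (f x : ℂ) * Complex.exp (-Complex.I * ((∑ j, ξ j * x j : ℝ) : ℂ))

theorem classicalFourier_neg {n : ℕ} (f : EuclideanSpace ℝ (Fin n) → ℝ)
    (ξ : EuclideanSpace ℝ (Fin n)) :
    classicalFourier f (-ξ) = starRingEnd ℂ (classicalFourier f ξ) := by
  unfold classicalFourier
  rw [map_mul, ← integral_conj]
  congr 1
  · simp only [map_inv₀, Complex.conj_ofReal]
  · congr 1
    funext x
    rw [map_mul, ← Complex.exp_conj]
    simp

/-- The Fourier transform of a real-valued function of classical variables as such a function `h`. -/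
def WeylSymbol.ofClassical {n : ℕ} (f : EuclideanSpace ℝ (Fin n) → ℝ)
    (h₀ : Integrable (classicalFourier f))
    (h₁ : Integrable fun ξ => ‖ξ‖ * ‖classicalFourier f ξ‖) : WeylSymbol n where
  h := classicalFourier f
  symm := classicalFourier_neg f
  integrable := h₀
  integrable_moment := h₁

/-- The twisted convolution
`h̃(ξ) = ∫ h(ξ - τ) h(τ) (ξ - τ) τᵀ exp (i τᵀ Θ ξ) dτ`, a complex matrix for every `ξ`. -/
def twistedConv {n : ℕ} (Θ : Matrix (Fin n) (Fin n) ℝ) (h : EuclideanSpace ℝ (Fin n) → ℂ)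
    (ξ : EuclideanSpace ℝ (Fin n)) : Matrix (Fin n) (Fin n) ℂ :=
  Matrix.of fun j k => ∫ τ : EuclideanSpace ℝ (Fin n),
    h (ξ - τ) * h τ * ((ξ - τ) j : ℂ) * (τ k : ℂ) *
      Complex.exp (Complex.I * ((∑ a, ∑ b, τ a * Θ a b * ξ b : ℝ) : ℂ))

namespace CCRSystem

variable {n : ℕ} {Θ : Matrix (Fin n) (Fin n) ℝ} {H : Type*}
  [NormedAddCommGroup H] [InnerProductSpace ℂ H] (S : CCRSystem Θ H)

/-- The linear combination `ξᵀX`. -/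
def lin (ξ : EuclideanSpace ℝ (Fin n)) : Module.End ℂ S.dom :=
  ∑ j, (ξ j : ℂ) • S.X j

/-- The operator `exp (i ξᵀX)`. -/
def weyl (ξ : EuclideanSpace ℝ (Fin n)) : H →L[ℂ] H :=
  expI (S.lin ξ)

/-- The system variable `X j` as a closed operator on `H`. -/
def closedX (j : Fin n) : H →ₗ.[ℂ] H :=
  LinearPMap.closure ⟨S.dom, S.dom.subtype ∘ₗ S.X j⟩

/-- `∫ g(ξ) exp (i ξᵀX) dξ` for a scalar function `g`. -/
def quantize (g : EuclideanSpace ℝ (Fin n) → ℂ) : H →L[ℂ] H :=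
  strongIntegral fun ξ => g ξ • S.weyl ξ

/-- The matrix `∫ G(ξ) exp (i ξᵀX) dξ` of operators for a matrix-valued function `G`. -/
def quantizeMat (G : EuclideanSpace ℝ (Fin n) → Matrix (Fin n) (Fin n) ℂ) :
    Matrix (Fin n) (Fin n) (H →L[ℂ] H) :=
  Matrix.of fun j k => S.quantize fun ξ => G ξ j k

/-- The perturbation vector `Z = i [H₁, X]` for the Hamiltonian `H₁ = ∫ h(ξ) exp (i ξᵀX) dξ`. -/
def perturbation (h : EuclideanSpace ℝ (Fin n) → ℂ) (j : Fin n) : H →L[ℂ] H :=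
  Complex.I • bddCommutator (S.quantize h) (S.closedX j)

/-- The matrix `Z Zᵀ` of operators. -/
def zzt (h : EuclideanSpace ℝ (Fin n) → ℂ) : Matrix (Fin n) (Fin n) (H →L[ℂ] H) :=
  Matrix.vecMulVec (S.perturbation h) (S.perturbation h)

/-- The matrix `4 Θ ∫ h̃(ξ) exp (i ξᵀX) dξ Θ` of operators. -/
def weylForm (h : EuclideanSpace ℝ (Fin n) → ℂ) : Matrix (Fin n) (Fin n) (H →L[ℂ] H) :=
  (4 : ℂ) • (scalarMat (H →L[ℂ] H) Θ * S.quantizeMat (twistedConv Θ h) * scalarMat (H →L[ℂ] H) Θ)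

/-- The matrix `μ₁ ∑ k, Γ k X Xᵀ (Γ k)ᵀ + μ₀ I` of operators on the domain of the `X j`. -/
def quadBound {d : ℕ} (Γ : Fin d → Matrix (Fin n) (Fin n) ℝ) (μ₁ μ₀ : ℝ) :
    Matrix (Fin n) (Fin n) (Module.End ℂ S.dom) :=
  (μ₁ : ℂ) • (∑ k, scalarMat (Module.End ℂ S.dom) (Γ k) * Matrix.vecMulVec S.X S.X *
    scalarMat (Module.End ℂ S.dom) (Γ k).transpose) + (μ₀ : ℂ) • 1

end CCRSystem

end

/-! On the invariant domain `D` everything is algebra with scalar commutators. If `[A, B] = c`, then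
`exp (tA) exp (tB) = exp (c t² / 2) exp (t (A + B))` as formal power series. With `A = iξᵀX` and `B
= iηᵀX` this gives `c = -2i ξᵀΘη`, and entire analyticity makes the series absolutely convergent on
`D`. Paired with vectors of `D`, the identity becomes the weak Weyl relation
`inner_weylSum_neg_weylSum`. Its case of opposite arguments shows that `exp (iξᵀX)` is isometric on
`D`, so it extends to `H`, where the Weyl relations `weyl_weyl` hold by density.

Two consequences carry the theorem. The Weyl relations and Fubini turn a product of two
quantizations into the quantization of a twisted convolution (`quantize_mul_quantize`). Conjugating
the closure of `X j` by an exponential shifts it by the scalar `2 (Θξ)_j`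
(`weyl_mem_graph_closedX`); integrating this against `h` gives `Z = 2iΘ ∫ h(ξ) ξ exp (iξᵀX) dξ`
(`isCommutator_quantize`, `perturbation_eq`).

Hence `Z Zᵀ = (2i)² Θ (∫ h ξ exp)(∫ h ξ exp)ᵀ Θᵀ`. The product in the middle is the quantization of
`h̃`, and `Θᵀ = -Θ` turns `-4` into `4`. The two inequalities are then about the same matrix. -/

/-! ### Formal exponential series with a scalar commutator. -/

section ExponentialSeries

variable {R : Type*} [Ring R] [Algebra ℂ R]

/-- The `k`-th term of the exponential series in a complex algebra. -/
noncomputable def expTerm (A : R) (k : ℕ) : R := ((k ! : ℂ)⁻¹) • A ^ k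

@[simp] theorem expTerm_zero (A : R) : expTerm A 0 = 1 := by simp [expTerm]

theorem succ_smul_expTerm_succ (A : R) (k : ℕ) :
    ((k + 1 : ℕ) : ℂ) • expTerm A (k + 1) = A * expTerm A k := by
  have h : ((k + 1 : ℕ) : ℂ) ≠ 0 := Nat.cast_ne_zero.mpr k.succ_ne_zero
  rw [expTerm, expTerm, smul_smul, Nat.factorial_succ, Nat.cast_mul, mul_inv, ← mul_assoc,
    mul_inv_cancel₀ h, one_mul, mul_smul_comm, pow_succ']

theorem pow_succ_mul_of_commutator {A B : R} {c : ℂ} (h : A * B - B * A = c • (1 : R)) (k : ℕ) :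
    A ^ (k + 1) * B = B * A ^ (k + 1) + (((k + 1 : ℕ) : ℂ) * c) • A ^ k := by
  have hAB : A * B = B * A + c • (1 : R) := by rw [← h]; abel
  induction k with
  | zero => simpa using hAB
  | succ k ih =>
    calc A ^ (k + 1 + 1) * B = A * (A ^ (k + 1) * B) := by rw [pow_succ', mul_assoc]
      _ = (A * B) * A ^ (k + 1) + (((k + 1 : ℕ) : ℂ) * c) • A ^ (k + 1) := by
        rw [ih, mul_add, mul_smul_comm, ← pow_succ', mul_assoc]
      _ = _ := by
        rw [hAB, add_mul, mul_assoc, ← pow_succ', smul_mul_assoc, one_mul, add_assoc, ← add_smul]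
        congr 2
        push_cast
        ring

theorem expTerm_succ_mul_of_commutator {A B : R} {c : ℂ} (h : A * B - B * A = c • (1 : R))
    (k : ℕ) : expTerm A (k + 1) * B = B * expTerm A (k + 1) + c • expTerm A k := by
  have hk : ((k + 1 : ℕ) : ℂ) ≠ 0 := Nat.cast_ne_zero.mpr k.succ_ne_zero
  rw [expTerm, smul_mul_assoc, pow_succ_mul_of_commutator h, smul_add, mul_smul_comm, expTerm,
    smul_smul, smul_smul]
  congr 2
  rw [Nat.factorial_succ, Nat.cast_mul]
  field_simp

theorem sum_smul_commutator {ι : Type*} [Fintype ι] {X : ι → R} {B : R} {c : ι → ℂ}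
    (h : ∀ j, X j * B - B * X j = c j • (1 : R)) (x : ι → ℂ) :
    (∑ j, x j • X j) * B - B * ∑ j, x j • X j = (∑ j, x j * c j) • (1 : R) := by
  simp only [Finset.sum_mul, Finset.mul_sum, ← Finset.sum_sub_distrib, smul_mul_assoc,
    mul_smul_comm, ← smul_sub, h, smul_smul, ← Finset.sum_smul]

theorem commutator_sum_smul {ι : Type*} [Fintype ι] {X : ι → R} {B : R} {c : ι → ℂ}
    (h : ∀ j, B * X j - X j * B = c j • (1 : R)) (x : ι → ℂ) :
    B * (∑ j, x j • X j) - (∑ j, x j • X j) * B = (∑ j, x j * c j) • (1 : R) := by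
  simp only [Finset.sum_mul, Finset.mul_sum, ← Finset.sum_sub_distrib, smul_mul_assoc,
    mul_smul_comm, ← smul_sub, h, smul_smul, ← Finset.sum_smul]

theorem smul_commutator_smul {A B : R} {c : ℂ} (h : A * B - B * A = c • (1 : R)) (a b : ℂ) :
    (a • A) * (b • B) - (b • B) * (a • A) = (a * b * c) • (1 : R) := by
  rw [smul_mul_smul_comm, smul_mul_smul_comm, mul_comm b a, ← smul_sub, h, smul_smul]

/-- The coefficients of the power series `exp (c t² / 2)`. -/
noncomputable def gaussCoeff (c : ℂ) (r : ℕ) : ℂ :=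
  if Even r then (c / 2) ^ (r / 2) / ((r / 2)! : ℂ) else 0

@[simp] theorem gaussCoeff_zero (c : ℂ) : gaussCoeff c 0 = 1 := by simp [gaussCoeff]

@[simp] theorem gaussCoeff_one (c : ℂ) : gaussCoeff c 1 = 0 := by simp [gaussCoeff]

theorem gaussCoeff_even (c : ℂ) (q : ℕ) : gaussCoeff c (2 * q) = (c / 2) ^ q / (q ! : ℂ) := by
  simp [gaussCoeff]

theorem gaussCoeff_odd (c : ℂ) (q : ℕ) : gaussCoeff c (2 * q + 1) = 0 := by
  simp [gaussCoeff]

/-- The differential equation `G' = c t G` of `G = exp (c t² / 2)`, read off coefficientwise. -/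
theorem succ_mul_gaussCoeff (c : ℂ) (r : ℕ) :
    ((r + 1 + 1 : ℕ) : ℂ) * gaussCoeff c (r + 1 + 1) = c * gaussCoeff c r := by
  rcases Nat.even_or_odd' r with ⟨q, rfl | rfl⟩
  · rw [show 2 * q + 1 + 1 = 2 * (q + 1) by ring, gaussCoeff_even, gaussCoeff_even,
      Nat.factorial_succ]
    have h : ((q + 1 : ℕ) : ℂ) ≠ 0 := Nat.cast_ne_zero.mpr q.succ_ne_zero
    have h' : (q ! : ℂ) ≠ 0 := Nat.cast_ne_zero.mpr q.factorial_ne_zero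
    push_cast at h ⊢
    field_simp
    ring
  · rw [show 2 * q + 1 + 1 + 1 = 2 * (q + 1) + 1 by ring, gaussCoeff_odd, gaussCoeff_odd]
    simp

theorem hasSum_norm_gaussCoeff (c : ℂ) :
    HasSum (fun r => ‖gaussCoeff c r‖) (Real.exp (‖c‖ / 2)) := by
  have he : HasSum (fun q => ‖gaussCoeff c (2 * q)‖) (Real.exp (‖c‖ / 2)) := by
    have := NormedSpace.expSeries_div_hasSum_exp (𝔸 := ℝ) (‖c‖ / 2)
    rw [← Real.exp_eq_exp_ℝ] at this
    simpa [gaussCoeff_even] using this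
  have ho : HasSum (fun q => ‖gaussCoeff c (2 * q + 1)‖) 0 := by
    simp only [gaussCoeff_odd, norm_zero]
    exact hasSum_zero
  have h := HasSum.even_add_odd (f := fun r => ‖gaussCoeff c r‖) he ho
  rwa [add_zero] at h

theorem hasSum_gaussCoeff (c : ℂ) : HasSum (gaussCoeff c) (Complex.exp (c / 2)) := by
  have he : HasSum (fun q => gaussCoeff c (2 * q)) (Complex.exp (c / 2)) := by
    have := NormedSpace.expSeries_div_hasSum_exp (𝔸 := ℂ) (c / 2)
    rw [← Complex.exp_eq_exp_ℂ] at this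
    simpa [gaussCoeff_even] using this
  have ho : HasSum (fun q => gaussCoeff c (2 * q + 1)) 0 := by
    simp only [gaussCoeff_odd]
    exact hasSum_zero
  have h := HasSum.even_add_odd he ho
  rwa [add_zero] at h

/-- Leibniz rule for Cauchy products: multiplying the coefficient of degree `m + 1` by `m + 1` is
differentiation in `t`. -/
theorem succ_smul_sum_antidiagonal {M : Type*} [AddCommGroup M] [Module ℂ M] (f : ℕ → ℕ → M)
    (m : ℕ) :
    ((m + 1 : ℕ) : ℂ) • ∑ p ∈ Finset.HasAntidiagonal.antidiagonal (m + 1), f p.1 p.2 =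
      ∑ p ∈ Finset.HasAntidiagonal.antidiagonal m, ((p.1 + 1 : ℕ) : ℂ) • f (p.1 + 1) p.2 +
      ∑ p ∈ Finset.HasAntidiagonal.antidiagonal m, ((p.2 + 1 : ℕ) : ℂ) • f p.1 (p.2 + 1) := by
  have h : ((m + 1 : ℕ) : ℂ) • ∑ p ∈ Finset.HasAntidiagonal.antidiagonal (m + 1), f p.1 p.2 =
      ∑ p ∈ Finset.HasAntidiagonal.antidiagonal (m + 1), (p.1 : ℂ) • f p.1 p.2 +
      ∑ p ∈ Finset.HasAntidiagonal.antidiagonal (m + 1), (p.2 : ℂ) • f p.1 p.2 := by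
    rw [Finset.smul_sum, ← Finset.sum_add_distrib]
    refine Finset.sum_congr rfl fun p hp => ?_
    rw [← add_smul, ← Nat.cast_add, Finset.HasAntidiagonal.mem_antidiagonal.mp hp]
  rw [h, Finset.Nat.sum_antidiagonal_succ, Finset.Nat.sum_antidiagonal_succ']
  simp

/-- Normal ordering: if the commutator `[A, B] = c` is scalar, then
`exp (t A) exp (t B) = exp (c t² / 2) exp (t (A + B))` as formal power series in `t`. -/
theorem sum_expTerm_mul_expTerm {A B : R} {c : ℂ} (h : A * B - B * A = c • (1 : R)) (m : ℕ) :
    ∑ p ∈ Finset.HasAntidiagonal.antidiagonal m, expTerm A p.1 * expTerm B p.2 =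
      ∑ p ∈ Finset.HasAntidiagonal.antidiagonal m, gaussCoeff c p.2 • expTerm (A + B) p.1 := by
  set P : ℕ → R := fun m => ∑ p ∈ Finset.HasAntidiagonal.antidiagonal m, expTerm A p.1 * expTerm B p.2 with hP
  set Q : ℕ → R := fun m =>
    ∑ p ∈ Finset.HasAntidiagonal.antidiagonal m, gaussCoeff c p.2 • expTerm (A + B) p.1 with hQ
  have hP' : ∀ m, ((m + 1 : ℕ) : ℂ) • P (m + 1) = A * P m +
      ∑ p ∈ Finset.HasAntidiagonal.antidiagonal m, expTerm A p.1 * B * expTerm B p.2 := by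
    intro m
    rw [hP, succ_smul_sum_antidiagonal (fun k l => expTerm A k * expTerm B l), Finset.mul_sum]
    congr 1
    · refine Finset.sum_congr rfl fun p _ => ?_
      rw [← smul_mul_assoc, succ_smul_expTerm_succ, mul_assoc]
    · refine Finset.sum_congr rfl fun p _ => ?_
      rw [← mul_smul_comm, succ_smul_expTerm_succ, mul_assoc]
  have hQ' : ∀ m, ((m + 1 : ℕ) : ℂ) • Q (m + 1) = (A + B) * Q m +
      ∑ p ∈ Finset.HasAntidiagonal.antidiagonal m,
        (((p.2 + 1 : ℕ) : ℂ) * gaussCoeff c (p.2 + 1)) • expTerm (A + B) p.1 := by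
    intro m
    rw [hQ, succ_smul_sum_antidiagonal (fun k l => gaussCoeff c l • expTerm (A + B) k),
      Finset.mul_sum]
    congr 1
    · refine Finset.sum_congr rfl fun p _ => ?_
      rw [smul_comm, succ_smul_expTerm_succ, mul_smul_comm]
    · refine Finset.sum_congr rfl fun p _ => ?_
      rw [smul_smul]
  have h0 : P 0 = Q 0 := by simp [hP, hQ]
  have h1 : P 1 = Q 1 := by
    have hp := hP' 0
    have hq := hQ' 0
    simp only [zero_add, Nat.cast_one, one_smul] at hp hq
    rw [hp, hq]
    simp [hP, hQ]
  -- Both series solve `F' = (A + B + c t) F`. For `P`, moving `B` to the left through the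
  -- exponential of `A` produces the extra `c t`; for `Q` it comes from the Gaussian factor. The
  -- resulting two-step recursion determines the coefficients from those of degree 0 and 1.
  have hP2 : ∀ m, ((m + 1 + 1 : ℕ) : ℂ) • P (m + 1 + 1) = (A + B) * P (m + 1) + c • P m := by
    intro m
    rw [hP' (m + 1), add_mul, add_assoc]
    congr 1
    rw [hP, Finset.mul_sum, Finset.Nat.sum_antidiagonal_succ, Finset.Nat.sum_antidiagonal_succ]
    simp only [expTerm_succ_mul_of_commutator h, expTerm_zero, one_mul, add_mul,
      Finset.sum_add_distrib, Finset.smul_sum, smul_mul_assoc, mul_assoc, add_assoc]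
  have hQ2 : ∀ m, ((m + 1 + 1 : ℕ) : ℂ) • Q (m + 1 + 1) = (A + B) * Q (m + 1) + c • Q m := by
    intro m
    rw [hQ' (m + 1)]
    congr 1
    rw [hQ, Finset.Nat.sum_antidiagonal_succ', Finset.smul_sum]
    simp only [succ_mul_gaussCoeff, smul_smul]
    simp
  have key : ∀ m, P m = Q m ∧ P (m + 1) = Q (m + 1) := by
    intro m
    induction m with
    | zero => exact ⟨h0, h1⟩
    | succ m ih =>
      refine ⟨ih.2, ?_⟩
      have hm : ((m + 1 + 1 : ℕ) : ℂ) ≠ 0 := Nat.cast_ne_zero.mpr (m + 1).succ_ne_zero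
      refine smul_right_injective R hm ?_
      simp only [hP2, hQ2, ih.1, ih.2]
  exact (key m).1

end ExponentialSeries

/-! ### The exponential series of `ξᵀX` on the invariant domain. -/

namespace CCRSystem

variable {n : ℕ} {Θ : Matrix (Fin n) (Fin n) ℝ} {H : Type*}
  [NormedAddCommGroup H] [InnerProductSpace ℂ H] (S : CCRSystem Θ H)

/-- The bilinear form `ξᵀ Θ η`. -/
def phase (Θ : Matrix (Fin n) (Fin n) ℝ) (ξ η : EuclideanSpace ℝ (Fin n)) : ℝ :=
  ∑ a, ∑ b, ξ a * Θ a b * η b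

theorem lin_apply (ξ : EuclideanSpace ℝ (Fin n)) (ψ : S.dom) :
    S.lin ξ ψ = ∑ j, (ξ j : ℂ) • S.X j ψ := by
  simp [lin]

theorem lin_add (ξ η : EuclideanSpace ℝ (Fin n)) : S.lin (ξ + η) = S.lin ξ + S.lin η := by
  simp only [lin, PiLp.add_apply, Complex.ofReal_add, add_smul, Finset.sum_add_distrib]

theorem lin_neg (ξ : EuclideanSpace ℝ (Fin n)) : S.lin (-ξ) = (-1 : ℂ) • S.lin ξ := by
  simp only [lin, Finset.smul_sum, smul_smul, PiLp.neg_apply, Complex.ofReal_neg, neg_one_mul]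

theorem lin_commutator_X (ξ : EuclideanSpace ℝ (Fin n)) (k : Fin n) :
    S.lin ξ * S.X k - S.X k * S.lin ξ =
      (∑ a, (ξ a : ℂ) * (2 * Complex.I * (Θ a k : ℂ))) • (1 : Module.End ℂ S.dom) :=
  sum_smul_commutator (R := Module.End ℂ S.dom) (fun j => S.ccr j k) _

theorem lin_commutator (ξ η : EuclideanSpace ℝ (Fin n)) :
    S.lin ξ * S.lin η - S.lin η * S.lin ξ =
      (2 * Complex.I * (phase Θ ξ η : ℂ)) • (1 : Module.End ℂ S.dom) := by
  refine (commutator_sum_smul (R := Module.End ℂ S.dom) (S.lin_commutator_X ξ) _).trans ?_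
  congr 1
  rw [phase, Finset.sum_comm]
  push_cast
  rw [Finset.mul_sum]
  refine Finset.sum_congr rfl fun a _ => ?_
  rw [Finset.mul_sum, Finset.mul_sum]
  exact Finset.sum_congr rfl fun b _ => by ring

theorem inner_lin (ξ : EuclideanSpace ℝ (Fin n)) (χ ψ : S.dom) :
    ⟪(S.lin ξ χ : H), (ψ : H)⟫_ℂ = ⟪(χ : H), (S.lin ξ ψ : H)⟫_ℂ := by
  simp [lin_apply, S.symm]

/-- The `k`-th term of the exponential series for `exp (i ξᵀX)`. -/
noncomputable def weylTerm (ξ : EuclideanSpace ℝ (Fin n)) (k : ℕ) : Module.End ℂ S.dom :=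
  expTerm (Complex.I • S.lin ξ) k

theorem weylTerm_apply (ξ : EuclideanSpace ℝ (Fin n)) (k : ℕ) (ψ : S.dom) :
    (S.weylTerm ξ k ψ : H) = (Complex.I ^ k / (k ! : ℂ)) • ((S.lin ξ ^ k) ψ : H) := by
  simp [weylTerm, expTerm, smul_pow, smul_smul, div_eq_inv_mul]

/-- Powers of `ξᵀX` are symmetric, and conjugation turns `I ^ k` into `(-I) ^ k`, a sign absorbed by
`-ξ`. -/
theorem inner_weylTerm_neg (ξ : EuclideanSpace ℝ (Fin n)) (k : ℕ) (χ ψ : S.dom) :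
    ⟪(S.weylTerm (-ξ) k χ : H), (ψ : H)⟫_ℂ = ⟪(χ : H), (S.weylTerm ξ k ψ : H)⟫_ℂ := by
  have hpow : ∀ (k : ℕ) (χ ψ : S.dom),
      ⟪((S.lin ξ ^ k) χ : H), (ψ : H)⟫_ℂ = ⟪(χ : H), ((S.lin ξ ^ k) ψ : H)⟫_ℂ := by
    intro k
    induction k with
    | zero => simp
    | succ k ih =>
      intro χ ψ
      nth_rewrite 1 [pow_succ']
      rw [pow_succ, Module.End.mul_apply, Module.End.mul_apply, S.inner_lin, ih]
  rw [weylTerm_apply, weylTerm_apply, lin_neg, smul_pow, LinearMap.smul_apply, Submodule.coe_smul,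
    smul_smul, inner_smul_left, inner_smul_right, ← hpow]
  congr 1
  simp only [map_mul, map_div₀, map_pow, Complex.conj_I, map_neg, map_one, map_natCast,
    div_mul_eq_mul_div, ← mul_pow]
  simp

/-- Expand the power into words in the `X j`; the coefficients have total mass `(∑ j, |ξ j|) ^ k`.
The vector stays universally quantified because the induction peels off the innermost letter and
replaces `ψ` by `X j ψ`. -/
theorem norm_lin_pow_le (ξ : EuclideanSpace ℝ (Fin n)) (k : ℕ) : ∀ (ψ : S.dom) (b : ℝ),
    (∀ w : List (Fin n), w.length = k → ‖((w.map S.X).prod ψ : H)‖ ≤ b) →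
    ‖((S.lin ξ ^ k) ψ : H)‖ ≤ (∑ j, |ξ j|) ^ k * b := by
  induction k with
  | zero => intro ψ b h; simpa using h [] rfl
  | succ k ih =>
    intro ψ b h
    rw [pow_succ, Module.End.mul_apply, lin_apply, map_sum, pow_succ, mul_assoc, Finset.sum_mul,
      Finset.mul_sum, Submodule.coe_sum]
    refine (norm_sum_le _ _).trans (Finset.sum_le_sum fun j _ => ?_)
    have := ih (S.X j ψ) b fun w hw => by
      simpa using h (w ++ [j]) (by simp [hw])
    rw [map_smul, Submodule.coe_smul, norm_smul, Complex.norm_real, Real.norm_eq_abs,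
      mul_left_comm]
    exact mul_le_mul_of_nonneg_left this (abs_nonneg _)

/-- The bound is uniform on an `ℓ¹` ball, which yields continuity in `ξ` as well as convergence. -/
theorem norm_weylTerm_le (ψ : S.dom) {r : ℝ} (hr : 0 < r) :
    ∃ C : ℝ, ∀ ξ : EuclideanSpace ℝ (Fin n), ∑ j, |ξ j| ≤ r → ∀ k,
      ‖(S.weylTerm ξ k ψ : H)‖ ≤ C * (1 / 2) ^ k := by
  -- Analyticity at twice the radius leaves the ratio `r / (2 * r) = 1 / 2`.
  obtain ⟨C, hC⟩ := S.entire ψ (2 * r) (by positivity)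
  refine ⟨C, fun ξ hξ k => ?_⟩
  have hC0 : 0 ≤ C := by simpa using (norm_nonneg _).trans (hC [])
  have hk : (0 : ℝ) < k ! := Nat.cast_pos.mpr k.factorial_pos
  have h := S.norm_lin_pow_le ξ k ψ (C * (k ! : ℝ) / (2 * r) ^ k) fun w hw => by
    simpa [hw] using hC w
  rw [weylTerm_apply, norm_smul, norm_div, norm_pow, Complex.norm_I, one_pow,
    Complex.norm_natCast]
  calc 1 / (k ! : ℝ) * ‖((S.lin ξ ^ k) ψ : H)‖
      ≤ 1 / (k ! : ℝ) * (r ^ k * (C * (k ! : ℝ) / (2 * r) ^ k)) := by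
        refine mul_le_mul_of_nonneg_left (h.trans ?_) (by positivity)
        gcongr
    _ = C * (1 / 2) ^ k := by
        rw [mul_pow, div_pow, one_pow]
        field_simp

theorem summable_norm_weylTerm (ξ : EuclideanSpace ℝ (Fin n)) (ψ : S.dom) :
    Summable fun k => ‖(S.weylTerm ξ k ψ : H)‖ := by
  obtain ⟨C, hC⟩ := S.norm_weylTerm_le ψ (r := ∑ j, |ξ j| + 1) (by positivity)
  exact Summable.of_nonneg_of_le (fun _ => norm_nonneg _) (hC ξ (by linarith))
    (summable_geometric_two.mul_left C)

theorem continuous_weylTerm (k : ℕ) (ψ : S.dom) :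
    Continuous fun ξ : EuclideanSpace ℝ (Fin n) => (S.weylTerm ξ k ψ : H) := by
  have h : ∀ ψ : S.dom, Continuous fun ξ : EuclideanSpace ℝ (Fin n) => ((S.lin ξ ^ k) ψ : H) := by
    induction k with
    | zero => intro ψ; simpa using continuous_const
    | succ k ih =>
      intro ψ
      simp only [pow_succ, Module.End.mul_apply, lin_apply, map_sum, map_smul, Submodule.coe_sum,
        Submodule.coe_smul]
      refine continuous_finsetSum _ fun j _ => Continuous.smul (by fun_prop) (ih _)
  simp only [weylTerm_apply]
  exact (h ψ).const_smul _

variable [CompleteSpace H]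

theorem summable_weylTerm (ξ : EuclideanSpace ℝ (Fin n)) (ψ : S.dom) :
    Summable fun k => (S.weylTerm ξ k ψ : H) :=
  (S.summable_norm_weylTerm ξ ψ).of_norm

/-- The sum of the exponential series for `exp (i ξᵀX) ψ`. -/
noncomputable def weylSum (ξ : EuclideanSpace ℝ (Fin n)) : S.dom →ₗ[ℂ] H where
  toFun ψ := ∑' k, (S.weylTerm ξ k ψ : H)
  map_add' ψ χ := by
    simp only [map_add, Submodule.coe_add]
    exact (S.summable_weylTerm ξ ψ).tsum_add (S.summable_weylTerm ξ χ)
  map_smul' c ψ := by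
    simp only [map_smul, Submodule.coe_smul, RingHom.id_apply]
    exact (S.summable_weylTerm ξ ψ).tsum_const_smul c

theorem hasSum_weylSum (ξ : EuclideanSpace ℝ (Fin n)) (ψ : S.dom) :
    HasSum (fun k => (S.weylTerm ξ k ψ : H)) (S.weylSum ξ ψ) :=
  (S.summable_weylTerm ξ ψ).hasSum

theorem weylSum_zero (ψ : S.dom) : S.weylSum 0 ψ = ψ := by
  refine (S.hasSum_weylSum 0 ψ).unique ?_
  have h0 : S.lin 0 = 0 := by simp [lin]
  convert hasSum_single (f := fun k => (S.weylTerm 0 k ψ : H)) 0 fun k hk => ?_ using 1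
  · simp [weylTerm]
  · simp [weylTerm_apply, h0, hk]

end CCRSystem

/-- The sum of an absolutely summable double series, taken along antidiagonals. -/
theorem Summable.tsum_prod_eq_tsum_sum_antidiagonal {E : Type*} [NormedAddCommGroup E]
    [CompleteSpace E] {f : ℕ × ℕ → E} (hf : Summable f) :
    ∑' p, f p = ∑' m, ∑ p ∈ Finset.HasAntidiagonal.antidiagonal m, f p := by
  rw [← Finset.HasAntidiagonal.sigmaAntidiagonalEquivProd.tsum_eq f]
  have := (Finset.HasAntidiagonal.sigmaAntidiagonalEquivProd.summable_iff (f := f)).mpr hf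
  refine (Summable.tsum_sigma' (fun m => (hasSum_fintype _).summable) this).trans
    (tsum_congr fun m => ?_)
  rw [tsum_fintype]
  exact Finset.sum_coe_sort (Finset.HasAntidiagonal.antidiagonal m) f

theorem tsum_inner_tsum {H : Type*} [NormedAddCommGroup H] [InnerProductSpace ℂ H]
    [CompleteSpace H] {u v : ℕ → H} (hu : Summable fun k => ‖u k‖) (hv : Summable fun k => ‖v k‖) :
    ⟪∑' k, u k, ∑' l, v l⟫_ℂ = ∑' m, ∑ p ∈ Finset.HasAntidiagonal.antidiagonal m, ⟪u p.1, v p.2⟫_ℂ := by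
  have hs : Summable fun p : ℕ × ℕ => ⟪u p.1, v p.2⟫_ℂ :=
    Summable.of_norm_bounded (hu.mul_of_nonneg hv (fun _ => norm_nonneg _) fun _ => norm_nonneg _)
      fun p => norm_inner_le_norm _ _
  rw [← hs.tsum_prod_eq_tsum_sum_antidiagonal, hs.tsum_prod]
  have h1 : ∀ x : H, ⟪∑' k, u k, x⟫_ℂ = ∑' k, ⟪u k, x⟫_ℂ := fun x => by
    have := (hu.of_norm.hasSum.mapL (innerSL ℂ x)).star.tsum_eq
    simpa using this.symm
  rw [h1]
  exact tsum_congr fun k => (innerSL ℂ (u k)).map_tsum hv.of_norm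

/-! ### The Weyl relations as identities between matrix elements. -/

namespace CCRSystem

variable {n : ℕ} {Θ : Matrix (Fin n) (Fin n) ℝ} {H : Type*}
  [NormedAddCommGroup H] [InnerProductSpace ℂ H] [CompleteSpace H] (S : CCRSystem Θ H)

/-- The sum for `η` may leave `D`, where the series for `ξ` is not available, so the latter acts on
`χ` with its sign reversed. Cauchy–Schwarz makes the double series absolutely convergent; on each
antidiagonal the terms move back onto `ψ` and `sum_expTerm_mul_expTerm` applies. The result is the
Cauchy product of the Gaussian series and the series for `ξ + η`. -/
theorem inner_weylSum_neg_weylSum (ξ η : EuclideanSpace ℝ (Fin n)) (χ ψ : S.dom) :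
    ⟪S.weylSum (-ξ) χ, S.weylSum η ψ⟫_ℂ =
      Complex.exp (-Complex.I * (phase Θ ξ η : ℂ)) * ⟪(χ : H), S.weylSum (ξ + η) ψ⟫_ℂ := by
  set c : ℂ := -(2 * Complex.I * (phase Θ ξ η : ℂ)) with hc
  have hcomm : (Complex.I • S.lin ξ) * (Complex.I • S.lin η) -
      (Complex.I • S.lin η) * (Complex.I • S.lin ξ) = c • (1 : Module.End ℂ S.dom) := by
    refine (smul_commutator_smul (R := Module.End ℂ S.dom) (S.lin_commutator ξ η) _ _).trans ?_
    rw [Complex.I_mul_I, neg_one_mul]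
  have hsum : Complex.I • S.lin ξ + Complex.I • S.lin η = Complex.I • S.lin (ξ + η) := by
    rw [lin_add, smul_add]
  have hR : ⟪(χ : H), S.weylSum (ξ + η) ψ⟫_ℂ = ∑' p, ⟪(χ : H), (S.weylTerm (ξ + η) p ψ : H)⟫_ℂ :=
    (innerSL ℂ (χ : H)).map_tsum (S.summable_weylTerm _ ψ)
  have hRs : Summable fun p => ‖⟪(χ : H), (S.weylTerm (ξ + η) p ψ : H)⟫_ℂ‖ :=
    Summable.of_nonneg_of_le (fun _ => norm_nonneg _) (fun p => norm_inner_le_norm _ _)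
      ((S.summable_norm_weylTerm (ξ + η) ψ).mul_left ‖(χ : H)‖)
  have hexp : Complex.exp (-Complex.I * (phase Θ ξ η : ℂ)) = ∑' r, gaussCoeff c r := by
    rw [(hasSum_gaussCoeff c).tsum_eq, hc]
    congr 1
    ring
  rw [hexp, hR, mul_comm, tsum_mul_tsum_eq_tsum_sum_antidiagonal_of_summable_norm hRs
    (hasSum_norm_gaussCoeff c).summable]
  refine (tsum_inner_tsum (S.summable_norm_weylTerm _ χ) (S.summable_norm_weylTerm _ ψ)).trans
    (tsum_congr fun m => ?_)
  have hm := congrArg (fun T : Module.End ℂ S.dom => ⟪(χ : H), (T ψ : H)⟫_ℂ)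
    (sum_expTerm_mul_expTerm hcomm m)
  simp only [hsum, LinearMap.sum_apply, LinearMap.smul_apply, Module.End.mul_apply,
    Submodule.coe_sum, Submodule.coe_smul, inner_sum, inner_smul_right] at hm
  simp only [S.inner_weylTerm_neg, mul_comm _ (gaussCoeff c _)]
  exact hm

end CCRSystem

/-! ### General facts on vector-valued integrals and bounded commutators. -/

theorem MeasureTheory.Integrable.smul_of_norm_le {α E : Type*} [MeasurableSpace α] {μ : Measure α}
    [NormedAddCommGroup E] [NormedSpace ℂ E] {f : α → ℂ} {v : α → E} (hf : Integrable f μ)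
    (hv : AEStronglyMeasurable v μ) {C : ℝ} (hC : ∀ a, ‖v a‖ ≤ C) :
    Integrable (fun a => f a • v a) μ :=
  (hf.norm.mul_const C).mono' (hf.aestronglyMeasurable.smul hv) <| Filter.Eventually.of_forall
    fun a => by
      rw [norm_smul]
      exact mul_le_mul_of_nonneg_left (hC a) (norm_nonneg _)

/-- A closed subspace contains the integrals of the integrable functions with values in it. -/
theorem Submodule.integral_mem_of_isClosed {α E : Type*} [MeasurableSpace α] {μ : Measure α}
    [NormedAddCommGroup E] [NormedSpace ℂ E] [CompleteSpace E] {G : Submodule ℂ E}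
    (hG : IsClosed (G : Set E)) {f : α → E} (hf : Integrable f μ) (hm : ∀ a, f a ∈ G) :
    ∫ a, f a ∂μ ∈ G := by
  -- Closedness makes the quotient a normed space, so its projection can be taken under the
  -- integral, where it annihilates the integrand.
  have : IsClosed (G.toAddSubgroup : Set E) := hG
  let q : E →L[ℂ] E ⧸ G := G.mkQL
  have h : q (∫ a, f a ∂μ) = ∫ a, q (f a) ∂μ := (q.integral_comp_comm hf).symm
  have h0 : ∀ a, q (f a) = 0 := fun a => (Submodule.Quotient.mk_eq_zero G).mpr (hm a)
  simp only [h0, integral_zero] at h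
  exact (Submodule.Quotient.mk_eq_zero G).mp h

theorem IsCommutator.unique {H : Type*} [NormedAddCommGroup H] [InnerProductSpace ℂ H]
    {T : H →L[ℂ] H} {A : H →ₗ.[ℂ] H} (hA : Dense (A.domain : Set H)) {C C' : H →L[ℂ] H}
    (h : IsCommutator T A C) (h' : IsCommutator T A C') : C = C' := by
  refine ContinuousLinearMap.ext fun x =>
    isClosed_property hA.denseRange_val (isClosed_eq C.continuous C'.continuous) (fun ψ => ?_) x
  obtain ⟨_, h₁⟩ := h ψ
  obtain ⟨_, h₂⟩ := h' ψ
  exact h₁.trans h₂.symm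

theorem IsCommutator.bddCommutator {H : Type*} [NormedAddCommGroup H] [InnerProductSpace ℂ H]
    {T : H →L[ℂ] H} {A : H →ₗ.[ℂ] H} {C : H →L[ℂ] H} (h : IsCommutator T A C) :
    IsCommutator T A (bddCommutator T A) := by
  have he : ∃ C : H →L[ℂ] H, IsCommutator T A C := ⟨C, h⟩
  rw [_root_.bddCommutator, dif_pos he]
  exact he.choose_spec

/-! ### Isometric Weyl operators, their strong integrals and the product formula. -/

namespace CCRSystem

variable {n : ℕ} {Θ : Matrix (Fin n) (Fin n) ℝ}

theorem phase_neg_left (ξ η : EuclideanSpace ℝ (Fin n)) : phase Θ (-ξ) η = -phase Θ ξ η := by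
  simp [phase]

theorem phase_zero_right (ξ : EuclideanSpace ℝ (Fin n)) : phase Θ ξ 0 = 0 := by
  simp [phase]

theorem phase_add_right (ξ η ζ : EuclideanSpace ℝ (Fin n)) :
    phase Θ ξ (η + ζ) = phase Θ ξ η + phase Θ ξ ζ := by
  simp [phase, mul_add, Finset.sum_add_distrib]

theorem phase_swap (hΘ : Θ.transpose = -Θ) (ξ η : EuclideanSpace ℝ (Fin n)) :
    phase Θ η ξ = -phase Θ ξ η := by
  have h : ∀ a b, Θ a b = -Θ b a := fun a b => congrFun (congrFun hΘ b) a
  rw [phase, Finset.sum_comm, phase, ← Finset.sum_neg_distrib]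
  refine Finset.sum_congr rfl fun a _ => ?_
  rw [← Finset.sum_neg_distrib]
  refine Finset.sum_congr rfl fun b _ => ?_
  rw [h b a]
  ring

theorem phase_self (hΘ : Θ.transpose = -Θ) (ξ : EuclideanSpace ℝ (Fin n)) : phase Θ ξ ξ = 0 :=
  self_eq_neg.mp (phase_swap hΘ ξ ξ)

theorem continuous_phase :
    Continuous fun p : EuclideanSpace ℝ (Fin n) × EuclideanSpace ℝ (Fin n) =>
      phase Θ p.1 p.2 := by
  unfold phase
  fun_prop

theorem norm_exp_I_mul_ofReal_eq_one (t : ℝ) : ‖Complex.exp (Complex.I * (t : ℂ))‖ = 1 := by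
  rw [mul_comm, Complex.norm_exp_ofReal_mul_I]

variable {H : Type*} [NormedAddCommGroup H] [InnerProductSpace ℂ H] [CompleteSpace H]
  (S : CCRSystem Θ H) (hΘ : Θ.transpose = -Θ)

omit [CompleteSpace H] in
theorem dense_induction {p : H → Prop} (hp : IsClosed {x | p x}) (h : ∀ ψ : S.dom, p ψ) (x : H) :
    p x :=
  isClosed_property S.dense_dom.denseRange_val hp h x

include hΘ

/-- The weak Weyl relation for `-ξ` and `ξ`: the phase `ξᵀΘξ` vanishes by antisymmetry and the
exponents cancel. -/
theorem norm_weylSum (ξ : EuclideanSpace ℝ (Fin n)) (ψ : S.dom) : ‖S.weylSum ξ ψ‖ = ‖(ψ : H)‖ := by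
  have h := S.inner_weylSum_neg_weylSum (-ξ) ξ ψ ψ
  rw [neg_neg, neg_add_cancel, weylSum_zero, phase_neg_left, phase_self hΘ, neg_zero,
    Complex.ofReal_zero, mul_zero, Complex.exp_zero, one_mul, inner_self_eq_norm_sq_to_K,
    inner_self_eq_norm_sq_to_K] at h
  have h' : ‖S.weylSum ξ ψ‖ ^ 2 = ‖(ψ : H)‖ ^ 2 := by exact_mod_cast h
  exact (sq_eq_sq₀ (norm_nonneg _) (norm_nonneg _)).mp h'

theorem isExpI_weyl (ξ : EuclideanSpace ℝ (Fin n)) : IsExpI (S.lin ξ) (S.weyl ξ) := by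
  have h : ∃ U : H →L[ℂ] H, IsExpI (S.lin ξ) U := by
    refine ⟨(S.weylSum ξ).extendOfNorm S.dom.subtype, fun ψ => ?_⟩
    have he : (S.weylSum ξ).extendOfNorm S.dom.subtype (ψ : H) = S.weylSum ξ ψ :=
      LinearMap.extendOfNorm_eq (e := S.dom.subtype) S.dense_dom.denseRange_val
        ⟨1, fun ψ => by rw [one_mul]; exact (S.norm_weylSum hΘ ξ ψ).le⟩ ψ
    rw [he]
    simpa only [weylTerm_apply] using S.hasSum_weylSum ξ ψ
  rw [weyl, expI, dif_pos h]
  exact h.choose_spec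

theorem weyl_coe (ξ : EuclideanSpace ℝ (Fin n)) (ψ : S.dom) : S.weyl ξ ψ = S.weylSum ξ ψ := by
  refine (S.isExpI_weyl hΘ ξ ψ).unique ?_
  simpa only [weylTerm_apply] using S.hasSum_weylSum ξ ψ

theorem norm_weyl (ξ : EuclideanSpace ℝ (Fin n)) (x : H) : ‖S.weyl ξ x‖ = ‖x‖ :=
  S.dense_induction (p := fun x => ‖S.weyl ξ x‖ = ‖x‖) (isClosed_eq (by fun_prop) continuous_norm)
    (fun ψ => by rw [S.weyl_coe hΘ, S.norm_weylSum hΘ]) x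

theorem inner_weyl_neg (ξ : EuclideanSpace ℝ (Fin n)) (x y : H) :
    ⟪S.weyl (-ξ) x, y⟫_ℂ = ⟪x, S.weyl ξ y⟫_ℂ := by
  refine S.dense_induction (p := fun x => ⟪S.weyl (-ξ) x, y⟫_ℂ = ⟪x, S.weyl ξ y⟫_ℂ)
    (isClosed_eq (by fun_prop) (by fun_prop)) (fun χ => ?_) x
  refine S.dense_induction (p := fun y => ⟪S.weyl (-ξ) χ, y⟫_ℂ = ⟪(χ : H), S.weyl ξ y⟫_ℂ)
    (isClosed_eq (by fun_prop) (by fun_prop)) (fun ψ => ?_) y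
  have h := S.inner_weylSum_neg_weylSum ξ 0 χ ψ
  rwa [weylSum_zero, phase_zero_right, Complex.ofReal_zero, mul_zero, Complex.exp_zero, one_mul,
    add_zero, ← S.weyl_coe hΘ, ← S.weyl_coe hΘ] at h

/-- The Weyl relations. -/
theorem weyl_weyl (ξ η : EuclideanSpace ℝ (Fin n)) (x : H) :
    S.weyl ξ (S.weyl η x) =
      Complex.exp (-Complex.I * (phase Θ ξ η : ℂ)) • S.weyl (ξ + η) x := by
  refine S.dense_induction (p := fun x => S.weyl ξ (S.weyl η x) =
    Complex.exp (-Complex.I * (phase Θ ξ η : ℂ)) • S.weyl (ξ + η) x)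
    (isClosed_eq (by fun_prop) (by fun_prop)) (fun ψ => ?_) x
  refine ext_inner_left ℂ fun y => ?_
  refine S.dense_induction (p := fun y => ⟪y, S.weyl ξ (S.weyl η ψ)⟫_ℂ =
    ⟪y, Complex.exp (-Complex.I * (phase Θ ξ η : ℂ)) • S.weyl (ξ + η) (ψ : H)⟫_ℂ)
    (isClosed_eq (by fun_prop) (by fun_prop)) (fun χ => ?_) y
  rw [← S.inner_weyl_neg hΘ, inner_smul_right, S.weyl_coe hΘ, S.weyl_coe hΘ, S.weyl_coe hΘ]
  exact S.inner_weylSum_neg_weylSum ξ η χ ψ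

/-- On `D` the series converges locally uniformly in `ξ`; an `ε / 3` argument passes to all of `H`
because every operator is isometric. This supplies the measurability needed for the strong
integrals. -/
theorem continuous_weyl (x : H) : Continuous fun ξ => S.weyl ξ x := by
  have hdom : ∀ ψ : S.dom, Continuous fun ξ => S.weyl ξ (ψ : H) := by
    intro ψ
    refine continuous_iff_continuousAt.mpr fun η => ?_
    set r : ℝ := ∑ j, |η j| + 1 with hr
    obtain ⟨C, hC⟩ := S.norm_weylTerm_le ψ (r := r) (by positivity)
    set U : Set (EuclideanSpace ℝ (Fin n)) := {ξ | ∑ j, |ξ j| < r} with hU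
    have hopen : IsOpen U := isOpen_lt (by fun_prop) continuous_const
    have hcont : ContinuousOn (fun ξ => S.weyl ξ (ψ : H)) U := by
      simp only [S.weyl_coe hΘ]
      exact continuousOn_tsum (fun k => (S.continuous_weylTerm k ψ).continuousOn)
        (summable_geometric_two.mul_left C) fun k ξ hξ => hC ξ hξ.le k
    exact hcont.continuousAt (hopen.mem_nhds (by simp [hU, hr]))
  refine Metric.continuous_iff.mpr fun ξ ε hε => ?_
  obtain ⟨y, hy, hxy⟩ := S.dense_dom.exists_dist_lt x (show 0 < ε / 3 by positivity)
  obtain ⟨δ, hδ, h⟩ := Metric.continuous_iff.mp (hdom ⟨y, hy⟩) ξ (ε / 3) (by positivity)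
  refine ⟨δ, hδ, fun η hη => ?_⟩
  have hd : ∀ ζ, dist (S.weyl ζ x) (S.weyl ζ y) < ε / 3 := fun ζ => by
    rwa [dist_eq_norm, ← map_sub, S.norm_weyl hΘ, ← dist_eq_norm]
  have h1 := hd η
  have h2 := hd ξ
  rw [dist_comm] at h2
  have h3 := dist_triangle4 (S.weyl η x) (S.weyl η y) (S.weyl ξ y) (S.weyl ξ x)
  linarith [h η hη]

theorem integrable_smul_weyl {g : EuclideanSpace ℝ (Fin n) → ℂ} (hg : Integrable g) (x : H) :
    Integrable fun ξ => g ξ • S.weyl ξ x :=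
  hg.smul_of_norm_le (S.continuous_weyl hΘ x).aestronglyMeasurable fun ξ => (S.norm_weyl hΘ ξ x).le

theorem isStrongIntegral_quantize {g : EuclideanSpace ℝ (Fin n) → ℂ} (hg : Integrable g) :
    IsStrongIntegral (fun ξ => g ξ • S.weyl ξ) (S.quantize g) := by
  have h : ∃ T : H →L[ℂ] H, IsStrongIntegral (fun ξ => g ξ • S.weyl ξ) T := by
    refine ⟨LinearMap.mkContinuous
      { toFun := fun x => ∫ ξ, g ξ • S.weyl ξ x
        map_add' := fun x y => by
          simp only [map_add, smul_add]
          exact integral_add (S.integrable_smul_weyl hΘ hg x) (S.integrable_smul_weyl hΘ hg y)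
        map_smul' := fun c x => by
          simp only [map_smul, smul_comm _ c, integral_smul, RingHom.id_apply] }
      (∫ ξ, ‖g ξ‖) fun x => ?_, fun x => ⟨S.integrable_smul_weyl hΘ hg x, rfl⟩⟩
    refine (norm_integral_le_integral_norm _).trans_eq ?_
    simp only [norm_smul, S.norm_weyl hΘ, integral_mul_const]
  rw [quantize, strongIntegral, dif_pos h]
  exact h.choose_spec

theorem quantize_apply {g : EuclideanSpace ℝ (Fin n) → ℂ} (hg : Integrable g) (x : H) :
    S.quantize g x = ∫ ξ, g ξ • S.weyl ξ x :=
  (S.isStrongIntegral_quantize hΘ hg x).2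

theorem quantize_sum_mul {ι : Type*} [Fintype ι] {g : ι → EuclideanSpace ℝ (Fin n) → ℂ}
    (hg : ∀ i, Integrable (g i)) (c : ι → ℂ) :
    S.quantize (fun ξ => ∑ i, c i * g i ξ) = ∑ i, c i • S.quantize (g i) := by
  have hs : Integrable fun ξ => ∑ i, c i * g i ξ :=
    integrable_finsetSum _ fun i _ => (hg i).const_mul (c i)
  ext x
  simp only [S.quantize_apply hΘ hs, sum_apply, smul_apply,
    S.quantize_apply hΘ (hg _), Finset.sum_smul, mul_smul, ← integral_smul]
  exact integral_finsetSum _ fun i _ => (S.integrable_smul_weyl hΘ (hg i) x).smul (c i)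

-- Up to a continuous unimodular factor this is the integrand of an ordinary convolution of
-- integrable functions.
omit hΘ in
theorem integrable_twisted {f g : EuclideanSpace ℝ (Fin n) → ℂ} (hf : Integrable f)
    (hg : Integrable g) :
    Integrable (fun p : EuclideanSpace ℝ (Fin n) × EuclideanSpace ℝ (Fin n) =>
      f (p.1 - p.2) * g p.2 * Complex.exp (Complex.I * (phase Θ p.2 p.1 : ℂ)))
      (volume.prod volume) := by
  have hc : Continuous fun p : EuclideanSpace ℝ (Fin n) × EuclideanSpace ℝ (Fin n) =>
      Complex.exp (Complex.I * (phase Θ p.2 p.1 : ℂ)) := by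
    have := (continuous_phase (Θ := Θ)).comp continuous_swap
    exact Complex.continuous_exp.comp
      (continuous_const.mul (Complex.continuous_ofReal.comp this))
  have h := (hg.convolution_integrand (ContinuousLinearMap.mul ℂ ℂ) hf).smul_of_norm_le
    hc.aestronglyMeasurable fun p => (norm_exp_I_mul_ofReal_eq_one _).le
  simpa only [ContinuousLinearMap.mul_apply', smul_eq_mul, mul_comm (g _)] using h

omit hΘ in
theorem integrable_integral_twisted {f g : EuclideanSpace ℝ (Fin n) → ℂ} (hf : Integrable f)
    (hg : Integrable g) :
    Integrable fun ξ => ∫ τ, f (ξ - τ) * g τ * Complex.exp (Complex.I * (phase Θ τ ξ : ℂ)) :=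
  (integrable_twisted hf hg).integral_prod_left

/-- The Weyl relation merges the two exponentials into one at `ξ + τ`, and the shift `ξ ↦ ξ - τ`
brings it to `ξ`. Fubini is needed before the shift (`hJ`) and after it (`hI`). -/
theorem quantize_mul_quantize {f g : EuclideanSpace ℝ (Fin n) → ℂ} (hf : Integrable f)
    (hg : Integrable g) :
    S.quantize f * S.quantize g = S.quantize fun ξ =>
      ∫ τ, f (ξ - τ) * g τ * Complex.exp (Complex.I * (phase Θ τ ξ : ℂ)) := by
  ext x
  have hI : Integrable (fun p : EuclideanSpace ℝ (Fin n) × EuclideanSpace ℝ (Fin n) =>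
      (f (p.1 - p.2) * g p.2 * Complex.exp (Complex.I * (phase Θ p.2 p.1 : ℂ))) • S.weyl p.1 x)
      (volume.prod volume) :=
    (integrable_twisted hf hg).smul_of_norm_le
      ((S.continuous_weyl hΘ x).comp continuous_fst).aestronglyMeasurable
      fun p => (S.norm_weyl hΘ _ x).le
  have hJ : Integrable (fun p : EuclideanSpace ℝ (Fin n) × EuclideanSpace ℝ (Fin n) =>
      (f p.1 * g p.2) •
        (Complex.exp (Complex.I * (phase Θ p.2 p.1 : ℂ)) • S.weyl (p.1 + p.2) x))
      (volume.prod volume) := by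
    refine (hf.mul_prod hg).smul_of_norm_le (C := ‖x‖) ?_ fun p => ?_
    · have := (continuous_phase (Θ := Θ)).comp continuous_swap
      exact Continuous.aestronglyMeasurable <| Continuous.smul (Complex.continuous_exp.comp
        (continuous_const.mul (Complex.continuous_ofReal.comp this)))
        ((S.continuous_weyl hΘ x).comp (continuous_fst.add continuous_snd))
    · rw [norm_smul, norm_exp_I_mul_ofReal_eq_one, one_mul, S.norm_weyl hΘ]
  rw [mul_apply_eq_comp, S.quantize_apply hΘ hf, S.quantize_apply hΘ hg,
    S.quantize_apply hΘ (integrable_integral_twisted hf hg)]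
  calc ∫ ξ, f ξ • S.weyl ξ (∫ τ, g τ • S.weyl τ x)
      = ∫ ξ, ∫ τ, (f ξ * g τ) •
          (Complex.exp (Complex.I * (phase Θ τ ξ : ℂ)) • S.weyl (ξ + τ) x) := by
        refine integral_congr_ae (Filter.Eventually.of_forall fun ξ => ?_)
        dsimp only
        rw [← (S.weyl ξ).integral_comp_comm (S.integrable_smul_weyl hΘ hg x), ← integral_smul]
        refine integral_congr_ae (Filter.Eventually.of_forall fun τ => ?_)
        dsimp only
        rw [map_smul, S.weyl_weyl hΘ, smul_smul, phase_swap hΘ ξ τ, Complex.ofReal_neg, mul_neg,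
          neg_mul]
    _ = ∫ τ, ∫ ξ, (f ξ * g τ) •
          (Complex.exp (Complex.I * (phase Θ τ ξ : ℂ)) • S.weyl (ξ + τ) x) :=
        integral_integral_swap hJ
    _ = ∫ τ, ∫ ξ, (f (ξ - τ) * g τ * Complex.exp (Complex.I * (phase Θ τ ξ : ℂ))) •
          S.weyl ξ x := by
        refine integral_congr_ae (Filter.Eventually.of_forall fun τ => ?_)
        dsimp only
        rw [← integral_sub_right_eq_self _ τ]
        refine integral_congr_ae (Filter.Eventually.of_forall fun ξ => ?_)
        -- The shift does not change the phase, since `τᵀΘτ = 0`.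
        have hp : phase Θ τ (ξ - τ) = phase Θ τ ξ := by
          have h := phase_add_right (Θ := Θ) τ (ξ - τ) τ
          rw [sub_add_cancel, phase_self hΘ, add_zero] at h
          exact h.symm
        simp only [sub_add_cancel, hp, smul_smul]
    _ = ∫ ξ, ∫ τ, (f (ξ - τ) * g τ * Complex.exp (Complex.I * (phase Θ τ ξ : ℂ))) •
          S.weyl ξ x := (integral_integral_swap hI).symm
    _ = _ := by
        refine integral_congr_ae (Filter.Eventually.of_forall fun ξ => ?_)
        exact integral_smul_const _ _

/-! ### Closures of the system variables and their commutators with quantizations. -/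

omit hΘ

/-- A densely defined symmetric operator is contained in its adjoint, which is closed. -/
theorem isClosable_X (j : Fin n) :
    (⟨S.dom, S.dom.subtype ∘ₗ S.X j⟩ : H →ₗ.[ℂ] H).IsClosable := by
  have hf : LinearPMap.IsFormalAdjoint (⟨S.dom, S.dom.subtype ∘ₗ S.X j⟩ : H →ₗ.[ℂ] H)
      ⟨S.dom, S.dom.subtype ∘ₗ S.X j⟩ := fun χ ψ => S.symm j χ ψ
  exact (LinearPMap.adjoint_isClosed S.dense_dom).isClosable.leIsClosable
    (hf.le_adjoint S.dense_dom)

theorem isClosed_graph_closedX (j : Fin n) : IsClosed ((S.closedX j).graph : Set (H × H)) :=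
  (S.isClosable_X j).closure_isClosed

theorem graph_closedX_le {j : Fin n} {G : Submodule ℂ (H × H)} (hG : IsClosed (G : Set (H × H)))
    (h : ∀ ψ : S.dom, ((ψ : H), (S.X j ψ : H)) ∈ G) : (S.closedX j).graph ≤ G := by
  rw [closedX, ← (S.isClosable_X j).graph_closure_eq_closure_graph]
  refine Submodule.topologicalClosure_minimal _ ?_ hG
  rintro ⟨x, y⟩ hxy
  obtain ⟨ψ, hx, hy⟩ := LinearPMap.mem_graph_iff _ |>.mp hxy
  dsimp only at hx hy
  rw [← hx, ← hy]
  exact h ψ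

omit [CompleteSpace H] in
theorem X_mem_graph_closedX (j : Fin n) (ψ : S.dom) :
    ((ψ : H), (S.X j ψ : H)) ∈ (S.closedX j).graph :=
  LinearPMap.le_graph_of_le (LinearPMap.le_closure _)
    (LinearPMap.mem_graph (⟨S.dom, S.dom.subtype ∘ₗ S.X j⟩ : H →ₗ.[ℂ] H) ψ)

omit [CompleteSpace H] in
theorem dense_domain_closedX (j : Fin n) : Dense ((S.closedX j).domain : Set H) :=
  S.dense_dom.mono fun x hx =>
    LinearPMap.mem_domain_of_mem_graph (S.X_mem_graph_closedX j ⟨x, hx⟩)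

include hΘ

/-- For `x ∈ D`, the partial sums of the exponential series lie in `D`, and their images under `X j`
converge by the termwise commutation rule. Closedness of the graph then places the limit in it, even
though `S.weyl ξ x` itself may leave `D`. -/
theorem weyl_mem_graph_closedX (ξ : EuclideanSpace ℝ (Fin n)) (j : Fin n) {x y : H}
    (h : (x, y) ∈ (S.closedX j).graph) :
    (S.weyl ξ x, S.weyl ξ y - (∑ a, 2 * (Θ j a : ℂ) * (ξ a : ℂ)) • S.weyl ξ x) ∈
      (S.closedX j).graph := by
  set c : ℂ := ∑ a, 2 * (Θ j a : ℂ) * (ξ a : ℂ) with hc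
  have hcomm : (Complex.I • S.lin ξ) * S.X j - S.X j * (Complex.I • S.lin ξ) =
      c • (1 : Module.End ℂ S.dom) := by
    have h1 := smul_commutator_smul (R := Module.End ℂ S.dom) (S.lin_commutator_X ξ j) Complex.I 1
    rw [one_smul] at h1
    refine h1.trans ?_
    congr 1
    rw [hc, Finset.mul_sum]
    refine Finset.sum_congr rfl fun a _ => ?_
    rw [show Θ a j = -Θ j a from congrFun (congrFun hΘ j) a, Complex.ofReal_neg]
    linear_combination (-2 * (ξ a : ℂ) * (Θ j a : ℂ)) * Complex.I_mul_I
  -- The claim says that the graph is invariant under this continuous map, so it suffices to test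
  -- pairs coming from `D`.
  let Φ : H × H →L[ℂ] H × H :=
    ((S.weyl ξ).comp (ContinuousLinearMap.fst ℂ H H)).prod
      ((S.weyl ξ).comp (ContinuousLinearMap.snd ℂ H H) -
        c • (S.weyl ξ).comp (ContinuousLinearMap.fst ℂ H H))
  suffices (S.closedX j).graph ≤ (S.closedX j).graph.comap Φ.toLinearMap from this h
  refine S.graph_closedX_le ((S.isClosed_graph_closedX j).preimage Φ.continuous) fun ψ => ?_
  change (S.weyl ξ (ψ : H), S.weyl ξ (S.X j ψ : H) - c • S.weyl ξ (ψ : H)) ∈ (S.closedX j).graph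
  have hψ := S.hasSum_weylSum ξ ψ
  have hX : HasSum (fun k => (S.X j (S.weylTerm ξ k ψ) : H))
      (S.weylSum ξ (S.X j ψ) - c • S.weylSum ξ ψ) := by
    -- The commutation rule relates term `k + 1` to term `k`; the zeroth term, `X j ψ` in both
    -- series, is split off and put back.
    have h1 := (hasSum_nat_add_iff' 1).mpr (S.hasSum_weylSum ξ (S.X j ψ))
    have h2 := (hasSum_nat_add_iff (f := fun k => (S.X j (S.weylTerm ξ k ψ) : H)) 1
      (g := S.weylSum ξ (S.X j ψ) - (S.X j ψ : H) - c • S.weylSum ξ ψ)).mp (by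
        convert h1.sub (hψ.const_smul c) using 1
        · funext k
          have := congrArg (fun T : Module.End ℂ S.dom => (T ψ : H))
            (expTerm_succ_mul_of_commutator (R := Module.End ℂ S.dom) hcomm k)
          exact eq_sub_of_add_eq this.symm
        · simp [weylTerm])
    convert h2 using 1
    simp [weylTerm]
    abel
  rw [S.weyl_coe hΘ, S.weyl_coe hΘ]
  exact (S.isClosed_graph_closedX j).mem_of_tendsto (hψ.prodMk hX)
    (Filter.Eventually.of_forall fun s =>
      Submodule.sum_mem _ fun k _ => S.X_mem_graph_closedX j (S.weylTerm ξ k ψ))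

/-- The graph relation for each exponential, weighted by `h ξ`, is integrated inside the closed
graph. This gives domain invariance and the value of the commutator at once. -/
theorem isCommutator_quantize {h : EuclideanSpace ℝ (Fin n) → ℂ} (hh : Integrable h)
    (hh' : ∀ a, Integrable fun ξ => h ξ * (ξ a : ℂ)) (j : Fin n) :
    IsCommutator (S.quantize h) (S.closedX j)
      (∑ a, (2 * (Θ j a : ℂ)) • S.quantize fun ξ => h ξ * (ξ a : ℂ)) := by
  have hs : Integrable fun ξ => ∑ a, (2 * (Θ j a : ℂ)) * (h ξ * (ξ a : ℂ)) :=
    integrable_finsetSum _ fun a _ => (hh' a).const_mul _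
  rw [← S.quantize_sum_mul hΘ hh']
  intro ψ
  have hI := ((S.integrable_smul_weyl hΘ hh (ψ : H))).prodMk
    ((S.integrable_smul_weyl hΘ hh (S.closedX j ψ)).sub (S.integrable_smul_weyl hΘ hs (ψ : H)))
  have hm := Submodule.integral_mem_of_isClosed (S.isClosed_graph_closedX j) hI fun ξ => by
    have := (S.closedX j).graph.smul_mem (h ξ)
      (S.weyl_mem_graph_closedX hΘ ξ j (LinearPMap.mem_graph (S.closedX j) ψ))
    convert this using 1
    refine Prod.ext rfl ?_
    simp only [Prod.smul_snd, smul_sub, smul_smul, Pi.sub_apply]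
    congr 2
    rw [Finset.mul_sum]
    exact Finset.sum_congr rfl fun a _ => by ring
  rw [integral_pair (S.integrable_smul_weyl hΘ hh (ψ : H))
    ((S.integrable_smul_weyl hΘ hh (S.closedX j ψ)).sub (S.integrable_smul_weyl hΘ hs (ψ : H))),
    integral_sub' (S.integrable_smul_weyl hΘ hh (S.closedX j ψ))
      (S.integrable_smul_weyl hΘ hs (ψ : H)), ← S.quantize_apply hΘ hh, ← S.quantize_apply hΘ hh,
    ← S.quantize_apply hΘ hs] at hm
  refine ⟨LinearPMap.mem_domain_of_mem_graph hm, ?_⟩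
  rw [(LinearPMap.image_iff (LinearPMap.mem_domain_of_mem_graph hm)).mpr hm |>.symm]
  abel

end CCRSystem

/-! ### Moments of the symbol and the formula for `Z Zᵀ`. -/

theorem WeylSymbol.integrable_mul_coord {n : ℕ} (s : WeylSymbol n) (a : Fin n) :
    Integrable fun ξ : EuclideanSpace ℝ (Fin n) => s.h ξ * (ξ a : ℂ) := by
  refine s.integrable_moment.mono' (s.integrable.aestronglyMeasurable.mul
    (Continuous.aestronglyMeasurable (by fun_prop))) (Filter.Eventually.of_forall fun ξ => ?_)
  rw [norm_mul, Complex.norm_real, mul_comm]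
  exact mul_le_mul_of_nonneg_right (PiLp.norm_apply_le ξ a) (norm_nonneg _)

theorem twistedConv_integrand {n : ℕ} (Θ : Matrix (Fin n) (Fin n) ℝ)
    (h : EuclideanSpace ℝ (Fin n) → ℂ) (ξ τ : EuclideanSpace ℝ (Fin n)) (j k : Fin n) :
    h (ξ - τ) * h τ * ((ξ - τ) j : ℂ) * (τ k : ℂ) *
        Complex.exp (Complex.I * ((∑ a, ∑ b, τ a * Θ a b * ξ b : ℝ) : ℂ)) =
      h (ξ - τ) * ((ξ - τ) j : ℂ) * (h τ * (τ k : ℂ)) *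
        Complex.exp (Complex.I * (CCRSystem.phase Θ τ ξ : ℂ)) := by
  rw [CCRSystem.phase]
  ring

theorem twistedConv_apply {n : ℕ} (Θ : Matrix (Fin n) (Fin n) ℝ)
    (h : EuclideanSpace ℝ (Fin n) → ℂ) (ξ : EuclideanSpace ℝ (Fin n)) (j k : Fin n) :
    twistedConv Θ h ξ j k = ∫ τ : EuclideanSpace ℝ (Fin n),
      h (ξ - τ) * ((ξ - τ) j : ℂ) * (h τ * (τ k : ℂ)) *
        Complex.exp (Complex.I * (CCRSystem.phase Θ τ ξ : ℂ)) := by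
  simp only [← twistedConv_integrand]
  rfl

theorem WeylSymbol.integrable_twistedConv {n : ℕ} (s : WeylSymbol n)
    (Θ : Matrix (Fin n) (Fin n) ℝ) (j k : Fin n) :
    Integrable fun ξ => twistedConv Θ s.h ξ j k := by
  simp only [twistedConv_apply]
  exact CCRSystem.integrable_integral_twisted (f := fun ξ => s.h ξ * (ξ j : ℂ))
    (g := fun ξ => s.h ξ * (ξ k : ℂ)) (s.integrable_mul_coord j) (s.integrable_mul_coord k)

namespace CCRSystem

variable {n : ℕ} {Θ : Matrix (Fin n) (Fin n) ℝ} {H : Type*} [NormedAddCommGroup H]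
  [InnerProductSpace ℂ H] [CompleteSpace H]

/-- Each entry of `h̃` is the twisted convolution of two coordinate moments of `h`, so the product
formula applies entrywise. -/
theorem quantizeMat_twistedConv (S : CCRSystem Θ H) (hΘ : Θ.transpose = -Θ) (s : WeylSymbol n)
    (j k : Fin n) :
    S.quantizeMat (twistedConv Θ s.h) j k =
      (S.quantize fun ξ => s.h ξ * (ξ j : ℂ)) * S.quantize fun ξ => s.h ξ * (ξ k : ℂ) := by
  rw [S.quantize_mul_quantize hΘ (s.integrable_mul_coord j) (s.integrable_mul_coord k)]
  simp only [quantizeMat, Matrix.of_apply, twistedConv_apply]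

theorem perturbation_eq (S : CCRSystem Θ H) (hΘ : Θ.transpose = -Θ) (s : WeylSymbol n)
    (j : Fin n) :
    S.perturbation s.h j =
      ∑ a, (Complex.I * (2 * (Θ j a : ℂ))) • S.quantize fun ξ => s.h ξ * (ξ a : ℂ) := by
  have h := S.isCommutator_quantize hΘ s.integrable s.integrable_mul_coord j
  rw [perturbation, h.bddCommutator.unique (S.dense_domain_closedX j) h, Finset.smul_sum]
  simp only [smul_smul]

theorem zzt_eq_weylForm (S : CCRSystem Θ H) (hΘ : Θ.transpose = -Θ) (s : WeylSymbol n) :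
    S.zzt s.h = S.weylForm s.h := by
  ext1 j k
  have hk : ∀ b, Θ b k = -Θ k b := fun b => congrFun (congrFun hΘ k) b
  simp only [zzt, Matrix.vecMulVec_apply, S.perturbation_eq hΘ, weylForm, Matrix.smul_apply,
    Matrix.mul_apply, scalarMat, Matrix.map_apply, S.quantizeMat_twistedConv hΘ, hk,
    Finset.sum_mul, Finset.mul_sum, Finset.smul_sum]
  refine Finset.sum_congr rfl fun b _ => Finset.sum_congr rfl fun a _ => ?_
  simp only [smul_mul_assoc, mul_smul_comm, one_mul, mul_one, smul_smul]
  congr 1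
  push_cast
  -- The factor `(2i)² = -4` meets the sign from `Θ b k = -Θ k b`.
  linear_combination (4 * (Θ j a : ℂ) * (Θ k b : ℂ)) * Complex.I_mul_I

end CCRSystem

theorem mainTheorem5 {n : ℕ} (Θ : Matrix (Fin n) (Fin n) ℝ) (hΘ : Θ.transpose = -Θ)
    (hdet : IsUnit Θ.det) {H : Type*} [NormedAddCommGroup H] [InnerProductSpace ℂ H]
    [CompleteSpace H] (S : CCRSystem Θ H) (s : WeylSymbol n) :
    -- the exponentials, the Hamiltonian, the vector `Z`, and `h̃` with its integral are well defined
    (∀ ξ, IsExpI (S.lin ξ) (S.weyl ξ)) ∧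
    IsStrongIntegral (fun ξ => s.h ξ • S.weyl ξ) (S.quantize s.h) ∧
    (∀ j, IsCommutator (S.quantize s.h) (S.closedX j)
      (bddCommutator (S.quantize s.h) (S.closedX j))) ∧
    (∀ j k, ∀ᵐ ξ : EuclideanSpace ℝ (Fin n), Integrable fun τ : EuclideanSpace ℝ (Fin n) =>
      s.h (ξ - τ) * s.h τ * ((ξ - τ) j : ℂ) * (τ k : ℂ) *
        Complex.exp (Complex.I * ((∑ a, ∑ b, τ a * Θ a b * ξ b : ℝ) : ℂ))) ∧
    (∀ j k, IsStrongIntegral (fun ξ => twistedConv Θ s.h ξ j k • S.weyl ξ)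
      (S.quantizeMat (twistedConv Θ s.h) j k)) ∧
    -- `Z Zᵀ` in Weyl quantization form
    S.zzt s.h = S.weylForm s.h ∧
    -- the two operator inequalities are equivalent
    ∀ (d : ℕ) (Γ : Fin d → Matrix (Fin n) (Fin n) ℝ) (μ₁ μ₀ : ℝ),
      SuperLE (boundedOn S.dom (S.zzt s.h)) (invariantOn S.dom (S.quadBound Γ μ₁ μ₀)) ↔
      SuperLE (boundedOn S.dom (S.weylForm s.h)) (invariantOn S.dom (S.quadBound Γ μ₁ μ₀)) := by
  refine ⟨S.isExpI_weyl hΘ, S.isStrongIntegral_quantize hΘ s.integrable, fun j =>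
    (S.isCommutator_quantize hΘ s.integrable s.integrable_mul_coord j).bddCommutator,
    fun j k => ?_, fun j k => S.isStrongIntegral_quantize hΘ (s.integrable_twistedConv Θ j k),
    -- The left sides of the two inequalities are equal matrices of bounded operators, so the
    -- equivalence is a rewrite.
    S.zzt_eq_weylForm hΘ s, fun d Γ μ₁ μ₀ => by rw [S.zzt_eq_weylForm hΘ s]⟩
  simp only [twistedConv_integrand]
  exact (CCRSystem.integrable_twisted (f := fun ξ => s.h ξ * (ξ j : ℂ))
    (g := fun ξ => s.h ξ * (ξ k : ℂ)) (s.integrable_mul_coord j) (s.integrable_mul_coord k)).prod_right_ae
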